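/- Let $\mathbb{K}=\mathbb{R}$ or $\mathbb{C}$. For $\mathbb{K}$-Banach spaces $E$, $F$, a mapping $Q\colon E\to F$ is a continuous $n$-homogeneous polynomial if $Q(x)=A(x,\dots,x)$ for some continuous $n$-linear mapping $A\colon E\times\cdots\times E\to F$. A sequence $(x_j)_{j=1}^\infty$ in $E$ is unconditionally $1$-summable if $\sum_j|\varphi(x_j)|<\infty$ for every $\varphi\in E'$ and $$\lim_{k\to\infty}\ \sup_{\varphi\in E',\,\|\varphi\|\le 1}\ \sum_{j\ge k}|\varphi(x_j)|=0 .$$ The $1$-summing set $S_1(Q)$ is the set of all $a\in E$ such that $\sum_j\|Q(a+x_j)-Q(a)\|<\infty$ for every unconditionally $1$-summable sequence $(x_j)_{j=1}^\infty$ in $E$. A set $A\subseteq E$ is lineable if $A\cup\{0\}$ contains an infinite-dimensional linear subspace of $E$. Let $n\ge 2$ be an integer. For every finite-dimensional subspace $G$ of $L_2([-\pi,\pi];\mathbb{K})$ there exists a continuous $n$-homogeneous polynomial $Q\colon L_2([-\pi,\pi];\mathbb{K})\to L_1([-\pi,\pi];\mathbb{K})$ such that $S_1(Q)=G$. In particular,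 there exists a continuous $n$-homogeneous polynomial $Q\colon L_2([-\pi,\pi];\mathbb{K})\to L_1([-\pi,\pi];\mathbb{K})$ whose summing set $S_1(Q)$ satisfies $S_1(Q)\neq\emptyset$, $S_1(Q)\neq\{0\}$ and is not lineable. -/

import Mathlib

open MeasureTheory Filter Topology
open scoped ENNReal

/-- `P : E → F` is a continuous `n`-homogeneous polynomial: the restriction to the diagonal of a
continuous `n`-linear mapping `E × ⋯ × E → F`. -/
def IsHomogeneousPolynomial (𝕜 : Type*) [RCLike 𝕜] {E F : Type*}
    [NormedAddCommGroup E] [NormedSpace 𝕜 E] [NormedAddCommGroup F] [NormedSpace 𝕜 F]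
    (n : ℕ) (P : E → F) : Prop :=
  ∃ A : ContinuousMultilinearMap 𝕜 (fun _ : Fin n => E) F, ∀ x : E, P x = A (fun _ => x)

/-- `(y j)` is absolutely `p`-summable, i.e. it belongs to `ℓ_p(F)`. -/
def AbsolutelySummable {F : Type*} [NormedAddCommGroup F] (p : ℝ) (y : ℕ → F) : Prop :=
  Summable fun j => ‖y j‖ ^ p

/-- `(x j)` is weakly `q`-summable, i.e. it belongs to `ℓ_q^w(E)`: the scalar sequence `(φ (x j))`
is in `ℓ_q` for every continuous linear functional `φ`. -/
def WeaklySummable (𝕜 : Type*) [RCLike 𝕜] {E : Type*} [NormedAddCommGroup E] [NormedSpace 𝕜 E]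
    (q : ℝ) (x : ℕ → E) : Prop :=
  ∀ φ : StrongDual 𝕜 E, AbsolutelySummable q fun j => φ (x j)

/-- The weak `ℓ_q` norm `sup {(∑ |φ (x j)| ^ q) ^ (1 / q) : ‖φ‖ ≤ 1}`, with values in `[0, ∞]`. -/
noncomputable def weakNorm (𝕜 : Type*) [RCLike 𝕜] {E : Type*}
    [NormedAddCommGroup E] [NormedSpace 𝕜 E] (q : ℝ) (x : ℕ → E) : ℝ≥0∞ :=
  ⨆ (φ : StrongDual 𝕜 E) (_ : ‖φ‖ ≤ 1), (∑' j, ‖φ (x j)‖ₑ ^ q) ^ (1 / q)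

/-- `(x j)` is unconditionally `q`-summable, i.e. it belongs to `ℓ_q^u(E)`: it is weakly
`q`-summable and the weak norms of its tails tend to `0`. -/
def UnconditionallySummable (𝕜 : Type*) [RCLike 𝕜] {E : Type*}
    [NormedAddCommGroup E] [NormedSpace 𝕜 E] (q : ℝ) (x : ℕ → E) : Prop :=
  WeaklySummable 𝕜 q x ∧ Tendsto (fun k => weakNorm 𝕜 q fun j => x (j + k)) atTop (𝓝 0)

/-- `f` is `(p; q)`-summing at the point `a`. -/
def IsSummingAt (𝕜 : Type*) [RCLike 𝕜] {E F : Type*}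
    [NormedAddCommGroup E] [NormedSpace 𝕜 E] [NormedAddCommGroup F]
    (p q : ℝ) (f : E → F) (a : E) : Prop :=
  ∀ x : ℕ → E, UnconditionallySummable 𝕜 q x → AbsolutelySummable p fun j => f (a + x j) - f a

/-- The `(p; q)`-summing set `S_{p;q}(f)`; `S_p(f)` is `summingSet 𝕜 p p f`. -/
def summingSet (𝕜 : Type*) [RCLike 𝕜] {E F : Type*}
    [NormedAddCommGroup E] [NormedSpace 𝕜 E] [NormedAddCommGroup F]
    (p q : ℝ) (f : E → F) : Set E :=
  {a | IsSummingAt 𝕜 p q f a}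

/-- `A` is lineable: `A ∪ {0}` contains an infinite-dimensional linear subspace. -/
def Lineable (𝕜 : Type*) [RCLike 𝕜] {E : Type*} [NormedAddCommGroup E] [NormedSpace 𝕜 E]
    (A : Set E) : Prop :=
  ∃ V : Submodule 𝕜 E, ¬ FiniteDimensional 𝕜 V ∧ (V : Set E) ⊆ A ∪ {0}

/-- The Banach space `L_p([-π, π]; 𝕜)` for Lebesgue measure. -/
abbrev LpInterval (𝕜 : Type*) [RCLike 𝕜] (p : ℝ≥0∞) : Type _ :=
  Lp 𝕜 p (volume.restrict (Set.Icc (-Real.pi) Real.pi))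

/-! Let `u` be the projection onto `Gᗮ`, write `n = m + 1`, and put `Q x = g (u x) * u x`, a
pointwise product L² × L² → L¹. Here `g w = ∑ 2⁻ᵏ (φ k w)ᵐ v k` is an `m`-homogeneous polynomial
vanishing only at 0, whose increments tend to 0 along weakly null increments of bounded arguments.
If `a ∈ G`, then `u a = 0` and the increment of `Q` at `a` is `Q x = O(‖x‖ⁿ)` with `n ≥ 2`; it is
summable because unconditionally summable sequences in a Hilbert space have square-summable norms
(`UnconditionallySummable.summable_norm_sq`). If `a ∉ G`, test with `x_j = v_j / (j + 1)`, where the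
`v_j` are normalised cosines. The increment is `g (u a) * v_j / (j + 1)` up to a relatively small
error, and `‖g (u a) * v_j‖₁` stays away from 0 (`exists_le_norm_lpMul_cosLp`), so the harmonic
series forces divergence. -/

/-! ### Unconditionally summable sequences in Hilbert space. -/

section Hilbert

variable {𝕜 : Type*} [RCLike 𝕜] {H : Type*} [NormedAddCommGroup H] [InnerProductSpace 𝕜 H]

/-- Each new sign is chosen to make the cross term with the previous partial sum nonnegative. -/
theorem exists_signs_sum_norm_sq_le {ι : Type*} (x : ι → H) (s : Finset ι) :
    ∃ ε : ι → 𝕜, (∀ i, ‖ε i‖ = 1) ∧ ∑ i ∈ s, ‖x i‖ ^ 2 ≤ ‖∑ i ∈ s, ε i • x i‖ ^ 2 := by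
  classical
  induction s using Finset.induction_on with
  | empty => exact ⟨fun _ => 1, by simp, by simp⟩
  | insert a s ha ih =>
    obtain ⟨ε, hε, h⟩ := ih
    obtain ⟨e, he, hre⟩ : ∃ e : 𝕜, ‖e‖ = 1 ∧
        0 ≤ RCLike.re (inner 𝕜 (e • x a) (∑ i ∈ s, ε i • x i)) := by
      rcases le_total 0 (RCLike.re (inner 𝕜 (x a) (∑ i ∈ s, ε i • x i))) with h0 | h0
      · exact ⟨1, by simp, by simpa using h0⟩
      · exact ⟨-1, by simp, by simpa using h0⟩
    refine ⟨fun i => if i = a then e else ε i, fun i => by dsimp only; split_ifs <;> simp [*], ?_⟩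
    have hs : ∑ i ∈ s, (if i = a then e else ε i) • x i = ∑ i ∈ s, ε i • x i :=
      Finset.sum_congr rfl fun i hi => by rw [if_neg (ne_of_mem_of_not_mem hi ha)]
    simp only [Finset.sum_insert ha, if_true]
    rw [hs,
      @norm_add_sq 𝕜, norm_smul, he, one_mul]
    linarith

theorem sum_norm_sq_le_one_of_sum_dual_le_one [CompleteSpace H] {ι : Type*} {x : ι → H}
    (s : Finset ι) (hx : ∀ φ : StrongDual 𝕜 H, ‖φ‖ ≤ 1 → ∑ i ∈ s, ‖φ (x i)‖ ≤ 1) :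
    ∑ i ∈ s, ‖x i‖ ^ 2 ≤ 1 := by
  obtain ⟨ε, hε, h⟩ := exists_signs_sum_norm_sq_le (𝕜 := 𝕜) x s
  refine h.trans (pow_le_one₀ (norm_nonneg _) ?_)
  obtain ⟨φ, hφ, hφS⟩ := exists_dual_vector'' 𝕜 (∑ i ∈ s, ε i • x i)
  have h1 : ‖∑ i ∈ s, ε i • x i‖ = ‖φ (∑ i ∈ s, ε i • x i)‖ := by
    rw [hφS, RCLike.norm_ofReal, abs_norm]
  rw [h1, map_sum]
  refine (norm_sum_le _ _).trans (le_trans (Finset.sum_le_sum fun i _ => ?_) (hx φ hφ))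
  rw [map_smul, norm_smul, hε, one_mul]

theorem UnconditionallySummable.summable_norm_sq [CompleteSpace H] {x : ℕ → H}
    (hx : UnconditionallySummable 𝕜 1 x) : Summable fun j => ‖x j‖ ^ 2 := by
  -- Only a tail of weak norm at most 1 is needed, which normalises the finite estimate.
  obtain ⟨k, hk⟩ := (hx.2.eventually (ge_mem_nhds (zero_lt_one' ℝ≥0∞))).exists
  rw [← summable_nat_add_iff k]
  refine summable_of_sum_le (fun _ => by positivity) (c := 1) fun s =>
    sum_norm_sq_le_one_of_sum_dual_le_one (𝕜 := 𝕜) s fun φ hφ => ?_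
  have h1 : ∑ j ∈ s, ‖φ (x (j + k))‖ₑ ≤ 1 := by
    refine le_trans ?_ hk
    refine le_trans ?_ (le_iSup₂ (f := fun (φ : StrongDual 𝕜 H) (_ : ‖φ‖ ≤ 1) =>
      (∑' j, ‖φ (x (j + k))‖ₑ ^ (1 : ℝ)) ^ (1 / (1 : ℝ))) φ hφ)
    simpa using ENNReal.sum_le_tsum s
  have h2 := ENNReal.toReal_mono ENNReal.one_ne_top h1
  rw [ENNReal.toReal_sum (by simp)] at h2
  simpa using h2

/-- Cauchy–Schwarz followed by Bessel, applied to the Riesz vector of `φ`. -/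
theorem Orthonormal.summable_smul_dual [CompleteSpace H] {ι : Type*} {v : ι → H}
    (hv : Orthonormal 𝕜 v) {l : ι → ℝ} (hl0 : ∀ i, 0 ≤ l i) (hl : Summable fun i => l i ^ 2)
    (φ : StrongDual 𝕜 H) :
    Summable (fun i => ‖φ ((l i : 𝕜) • v i)‖) ∧
      ∑' i, ‖φ ((l i : 𝕜) • v i)‖ ≤ √(∑' i, l i ^ 2) * ‖φ‖ := by
  set z := (InnerProductSpace.toDual 𝕜 H).symm φ with hz
  have hφ : ∀ i, ‖φ ((l i : 𝕜) • v i)‖ = l i * ‖inner 𝕜 (v i) z‖ := fun i => by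
    rw [map_smul, norm_smul, RCLike.norm_ofReal, abs_of_nonneg (hl0 i), norm_inner_symm, hz,
      InnerProductSpace.toDual_symm_apply]
  have hnorm : ‖z‖ = ‖φ‖ := by simp [hz]
  have hin := hv.inner_products_summable z
  have key := Real.summable_and_inner_le_Lp_mul_Lq_tsum_of_nonneg (f := l)
    (g := fun i => ‖inner 𝕜 (v i) z‖) Real.HolderConjugate.two_two hl0 (fun _ => norm_nonneg _)
    (by simpa using hl) (by simpa using hin)
  simp only [hφ]
  refine ⟨key.1, key.2.trans ?_⟩
  simp only [Real.rpow_two, ← Real.sqrt_eq_rpow]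
  gcongr
  rw [Real.sqrt_le_left (norm_nonneg _), ← hnorm]
  exact hv.tsum_inner_products_le z

theorem Orthonormal.unconditionallySummable_smul [CompleteSpace H] {v : ℕ → H}
    (hv : Orthonormal 𝕜 v) {l : ℕ → ℝ} (hl0 : ∀ i, 0 ≤ l i) (hl : Summable fun i => l i ^ 2) :
    UnconditionallySummable 𝕜 1 fun i => (l i : 𝕜) • v i := by
  refine ⟨fun φ => ?_, ?_⟩
  · simpa [AbsolutelySummable] using (hv.summable_smul_dual hl0 hl φ).1
  · have hlim : Tendsto (fun k => ENNReal.ofReal √(∑' j, l (j + k) ^ 2)) atTop (𝓝 0) := by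
      have := (tendsto_sum_nat_add fun i => l i ^ 2).sqrt
      simpa using ENNReal.tendsto_ofReal this
    refine tendsto_of_tendsto_of_tendsto_of_le_of_le tendsto_const_nhds hlim
      (fun _ => zero_le) fun k => iSup₂_le fun φ hφ => ?_
    have hvk : Orthonormal 𝕜 fun j => v (j + k) := hv.comp _ (add_left_injective k)
    obtain ⟨h1, h2⟩ := hvk.summable_smul_dual (l := fun j => l (j + k)) (fun _ => hl0 _)
      ((summable_nat_add_iff k).2 hl) φ
    simp only [ENNReal.rpow_one, div_one, ← ofReal_norm]
    rw [← ENNReal.ofReal_tsum_of_nonneg (fun _ => norm_nonneg _) h1]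
    refine ENNReal.ofReal_le_ofReal (h2.trans ?_)
    exact mul_le_of_le_one_right (Real.sqrt_nonneg _) hφ

theorem Orthonormal.tendsto_inner_zero {v : ℕ → H} (hv : Orthonormal 𝕜 v) (z : H) :
    Tendsto (fun j => inner 𝕜 z (v j)) atTop (𝓝 0) := by
  have h := (hv.inner_products_summable z).tendsto_atTop_zero.sqrt
  rw [tendsto_zero_iff_norm_tendsto_zero]
  simpa [Real.sqrt_sq, norm_inner_symm] using h

theorem Orthonormal.tendsto_starProjection_zero {v : ℕ → H} (hv : Orthonormal 𝕜 v)
    (G : Submodule 𝕜 H) [FiniteDimensional 𝕜 G] :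
    Tendsto (fun j => G.starProjection (v j)) atTop (𝓝 0) := by
  rw [OrthonormalBasis.starProjection_eq_sum_rankOne (stdOrthonormalBasis 𝕜 G)]
  simp only [sum_apply, InnerProductSpace.rankOne_apply]
  rw [← Finset.sum_const_zero]
  refine tendsto_finsetSum _ fun i _ => ?_
  simpa using (hv.tendsto_inner_zero _).smul_const
    ((stdOrthonormalBasis 𝕜 G i : G) : H)

end Hilbert

/-! ### A weakly continuous polynomial with trivial zero set. -/

section Diagonal

variable {𝕜 : Type*} [RCLike 𝕜] {H : Type*} [NormedAddCommGroup H] [InnerProductSpace 𝕜 H]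

theorem norm_pow_sub_pow_le_of_norm_le {z w : 𝕜} {R : ℝ} (hR : 1 ≤ R) (hz : ‖z‖ ≤ R)
    (hw : ‖w‖ ≤ R) (m : ℕ) : ‖z ^ m - w ^ m‖ ≤ m * R ^ m * ‖z - w‖ := by
  induction m with
  | zero => simp
  | succ m ih =>
    have h : z ^ (m + 1) - w ^ (m + 1) = z ^ m * (z - w) + (z ^ m - w ^ m) * w := by ring
    have hRm : R ^ m ≤ R ^ (m + 1) := pow_le_pow_right₀ hR m.le_succ
    calc ‖z ^ (m + 1) - w ^ (m + 1)‖ ≤ ‖z‖ ^ m * ‖z - w‖ + ‖z ^ m - w ^ m‖ * ‖w‖ := by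
          rw [h]
          refine (norm_add_le _ _).trans_eq ?_
          rw [norm_mul, norm_mul, norm_pow]
      _ ≤ R ^ m * ‖z - w‖ + (m * R ^ m * ‖z - w‖) * R := by gcongr
      _ ≤ R ^ (m + 1) * ‖z - w‖ + (m * R ^ m * ‖z - w‖) * R := by gcongr
      _ = (m + 1 : ℕ) * R ^ (m + 1) * ‖z - w‖ := by push_cast; ring

variable (𝕜 H) in
theorem exists_separating_dual_seq [TopologicalSpace.SeparableSpace H] :
    ∃ φ : ℕ → StrongDual 𝕜 H, (∀ k, ‖φ k‖ ≤ 1) ∧ ∀ w, (∀ k, φ k w = 0) → w = 0 := by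
  set d := TopologicalSpace.denseSeq H
  refine ⟨fun k => ((‖d k‖ : 𝕜)⁻¹) • innerSL 𝕜 (d k), fun k => ?_, fun w hw => ?_⟩
  · rw [norm_smul, innerSL_apply_norm, norm_inv, RCLike.norm_ofReal, abs_norm]
    exact inv_mul_le_one
  · refine (TopologicalSpace.denseRange_denseSeq H).eq_zero_of_inner_right 𝕜 fun k => ?_
    have h : (‖d k‖ : 𝕜)⁻¹ * inner 𝕜 (d k) w = 0 := hw k
    rcases mul_eq_zero.1 h with h | h
    -- The normalising factor vanishes only when `d k = 0`, since `0⁻¹ = 0`.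
    · have : d k = 0 := by simpa using h
      rw [show TopologicalSpace.denseSeq H k = 0 from this, inner_zero_left]
    · exact h

/-- `N x = ∑ 2⁻ᵏ ‖φ k x‖` is a seminorm controlling increments of `g` on balls; its geometric
weights make it tend to 0 on bounded weakly null sequences. -/
theorem exists_diagonal_polynomial [CompleteSpace H] [TopologicalSpace.SeparableSpace H]
    {v : ℕ → H} (hv : Orthonormal 𝕜 v) {m : ℕ} (hm : m ≠ 0) :
    ∃ (g : ContinuousMultilinearMap 𝕜 (fun _ : Fin m => H) H) (N : H → ℝ),
      (∀ w, (g fun _ => w) = 0 → w = 0) ∧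
      (∀ (c : 𝕜) y, N (c • y) = ‖c‖ * N y) ∧
      (∀ R, ∃ K, ∀ x b, ‖x‖ ≤ R → ‖b‖ ≤ R →
        ‖(g fun _ => x) - g fun _ => b‖ ≤ K * N (x - b)) ∧
      ∀ y : ℕ → H, (∀ j, ‖y j‖ ≤ 1) → (∀ φ : StrongDual 𝕜 H, Tendsto (fun j => φ (y j)) atTop (𝓝 0)) →
        Tendsto (fun j => N (y j)) atTop (𝓝 0) := by
  obtain ⟨φ, hφ1, hφ⟩ := exists_separating_dual_seq 𝕜 H
  have hφle : ∀ k x, ‖φ k x‖ ≤ ‖x‖ := fun k x =>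
    ((φ k).le_opNorm x).trans (mul_le_of_le_one_left (norm_nonneg _) (hφ1 k))
  let c : ℕ → ℝ := fun k => (1 / 2) ^ k
  have hc0 : ∀ k, 0 < c k := fun k => by positivity
  have hc : Summable c := summable_geometric_two
  let T : ℕ → ContinuousMultilinearMap 𝕜 (fun _ : Fin m => H) H := fun k =>
    ((ContinuousMultilinearMap.mkPiAlgebra 𝕜 (Fin m) 𝕜).compContinuousLinearMap
      fun _ => φ k).smulRight ((c k : 𝕜) • v k)
  have hTn : ∀ k, ‖T k‖ ≤ c k := fun k => by
    rw [ContinuousMultilinearMap.norm_smulRight, norm_smul, hv.1, mul_one, RCLike.norm_ofReal,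
      abs_of_pos (hc0 k)]
    refine mul_le_of_le_one_left (hc0 k).le
      ((ContinuousMultilinearMap.norm_compContinuousLinearMap_le _ _).trans ?_)
    rw [ContinuousMultilinearMap.norm_mkPiAlgebra, one_mul]
    exact Finset.prod_le_one (fun _ _ => norm_nonneg _) fun _ _ => hφ1 k
  have hT : Summable T := Summable.of_norm_bounded hc hTn
  have hTa : ∀ k x, (T k fun _ => x) = (φ k x) ^ m • (c k : 𝕜) • v k := fun k x => by
    simp [T, ContinuousMultilinearMap.smulRight_apply]
  have hg : ∀ x, HasSum (fun k => (φ k x) ^ m • (c k : 𝕜) • v k) ((∑' k, T k) fun _ => x) :=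
    fun x => by
      simpa only [hTa] using ContinuousMultilinearMap.hasSum_eval hT.hasSum fun _ => x
  have hNs : ∀ x, Summable fun k => c k * ‖φ k x‖ := fun x =>
    Summable.of_nonneg_of_le (fun k => mul_nonneg (hc0 k).le (norm_nonneg _))
      (fun k => mul_le_mul_of_nonneg_left (hφle k x) (hc0 k).le) (hc.mul_right ‖x‖)
  refine ⟨∑' k, T k, fun x => ∑' k, c k * ‖φ k x‖, fun w hw => hφ w fun k => ?_,
    fun a y => ?_, fun R => ⟨m * (max R 1) ^ m, fun x b hx hb => ?_⟩, fun y hy hw => ?_⟩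
  -- Pairing with `v k` isolates the coefficient `c k * (φ k w) ^ m`.
  · have h1 : HasSum (fun i => inner 𝕜 (v k) ((φ i w) ^ m • (c i : 𝕜) • v i)) 0 := by
      have := (hg w).mapL (innerSL 𝕜 (v k))
      rw [hw, map_zero] at this
      exact this
    have h2 := h1.unique (hasSum_single k fun i hi => by
      rw [inner_smul_right, inner_smul_right, hv.2 hi.symm, mul_zero, mul_zero])
    rw [inner_smul_right, inner_smul_right, inner_self_eq_norm_sq_to_K, hv.1] at h2
    have hck : (c k : 𝕜) ≠ 0 := by exact_mod_cast (hc0 k).ne'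
    exact pow_eq_zero_iff hm |>.1 (by simpa [hck] using h2.symm)
  · simp only [map_smul, norm_smul, ← tsum_mul_left]
    exact tsum_congr fun k => by ring
  · have h1 := (hg x).sub (hg b)
    refine h1.norm_le_of_bounded ((hNs (x - b)).hasSum.mul_left _) fun k => ?_
    rw [← sub_smul, norm_smul, norm_smul, hv.1, mul_one, RCLike.norm_ofReal,
      abs_of_pos (hc0 k), map_sub]
    have := norm_pow_sub_pow_le_of_norm_le (le_max_right R 1)
      ((hφle k x).trans (hx.trans (le_max_left R 1)))
      ((hφle k b).trans (hb.trans (le_max_left R 1))) m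
    calc _ ≤ (m * (max R 1) ^ m * ‖φ k x - φ k b‖) * c k := by gcongr
      _ = _ := by ring
  · rw [← tsum_zero (β := ℕ)]
    refine tendsto_tsum_of_dominated_convergence hc (fun k => ?_) (.of_forall fun j k => ?_)
    · simpa using ((hw (φ k)).norm.const_mul (c k))
    · rw [norm_mul, norm_norm, Real.norm_of_nonneg (hc0 k).le]
      exact mul_le_of_le_one_right (hc0 k).le ((hφle k _).trans (hy j))

end Diagonal

/-! ### Summing sets of the polynomials `B (g (u x)) (u x)`. -/

section SummingSet

variable {𝕜 : Type*} [RCLike 𝕜] {H : Type*} [NormedAddCommGroup H] [InnerProductSpace 𝕜 H]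
  {F : Type*} [NormedAddCommGroup F]

theorem isHomogeneousPolynomial_bilin [NormedSpace 𝕜 F] {m : ℕ} (B : H →L[𝕜] H →L[𝕜] F)
    (g : ContinuousMultilinearMap 𝕜 (fun _ : Fin m => H) H) (u : H →L[𝕜] H) :
    IsHomogeneousPolynomial 𝕜 (m + 1) fun x => B (g fun _ => u x) (u x) :=
  ⟨ContinuousMultilinearMap.uncurryRight (Ei := fun _ => H)
    ((((ContinuousLinearMap.compL 𝕜 H H F).flip u).comp B).compContinuousMultilinearMap
      (g.compContinuousLinearMap fun _ => u)), fun _ => rfl⟩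

theorem isSummingAt_of_norm_le_pow [CompleteSpace H] {Q : H → F} {a : H} {m : ℕ} (hm : m ≠ 0)
    {C : ℝ} (h : ∀ x, ‖Q (a + x) - Q a‖ ≤ C * ‖x‖ ^ (m + 1)) : IsSummingAt 𝕜 1 1 Q a := by
  intro x hx
  have hs := hx.summable_norm_sq
  have h0 : ∀ᶠ j in atTop, ‖x j‖ ^ 2 < 1 :=
    hs.tendsto_atTop_zero.eventually (gt_mem_nhds zero_lt_one)
  simp only [AbsolutelySummable, Real.rpow_one]
  refine Summable.of_norm_bounded_eventually_nat (hs.mul_left |C|) ?_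
  filter_upwards [h0] with j hj
  have hj1 : ‖x j‖ ≤ 1 := (sq_lt_one_iff₀ (norm_nonneg _)).1 hj |>.le
  rw [norm_norm]
  refine (h _).trans (mul_le_mul (le_abs_self C) ?_ (by positivity) (abs_nonneg C))
  -- Since `m + 1 ≥ 2` and `‖x j‖ ≤ 1`, the square dominates.
  exact pow_le_pow_of_le_one (norm_nonneg _) hj1 (by omega)

theorem not_isSummingAt_of_eventually_le [CompleteSpace H] {Q : H → F} {a : H} {v : ℕ → H}
    (hv : Orthonormal 𝕜 v) {c : ℝ} (hc : 0 < c)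
    (h : ∀ᶠ j : ℕ in atTop, c * (1 / ((j : ℝ) + 1)) ≤
      ‖Q (a + ((1 / ((j : ℝ) + 1) : ℝ) : 𝕜) • v j) - Q a‖) : ¬ IsSummingAt 𝕜 1 1 Q a := by
  intro hQ
  have hl : Summable fun j : ℕ => (1 / ((j : ℝ) + 1)) ^ 2 := by
    have := (summable_nat_add_iff 1).2 (Real.summable_one_div_nat_pow.2 one_lt_two)
    simpa using this
  have hs := hQ _ (hv.unconditionallySummable_smul (fun j => by positivity) hl)
  simp only [AbsolutelySummable, Real.rpow_one] at hs
  have h1 : Summable fun j : ℕ => c * (1 / ((j : ℝ) + 1)) := by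
    refine Summable.of_norm_bounded_eventually_nat hs ?_
    filter_upwards [h] with j hj
    rwa [Real.norm_of_nonneg (by positivity)]
  have h2 := (summable_mul_left_iff hc.ne').1 h1
  refine Real.not_summable_one_div_natCast ((summable_nat_add_iff 1).1 ?_)
  simpa using h2

theorem isSummingAt_bilin_of_map_eq_zero [CompleteSpace H] [NormedSpace 𝕜 F] {m : ℕ} (hm : m ≠ 0)
    (B : H →L[𝕜] H →L[𝕜] F) (g : ContinuousMultilinearMap 𝕜 (fun _ : Fin m => H) H)
    (u : H →L[𝕜] H) {a : H} (hua : u a = 0) :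
    IsSummingAt 𝕜 1 1 (fun x => B (g fun _ => u x) (u x)) a := by
  refine isSummingAt_of_norm_le_pow hm (C := ‖B‖ * (‖g‖ * ‖u‖ ^ m) * ‖u‖) fun x => ?_
  have hgx : ‖g fun _ => u x‖ ≤ ‖g‖ * (‖u‖ * ‖x‖) ^ m := by
    refine (g.le_opNorm _).trans ?_
    rw [Finset.prod_const, Finset.card_univ, Fintype.card_fin]
    gcongr
    exact u.le_opNorm x
  have h0 : B (g fun _ => u a) (u a) = 0 := by rw [hua, map_zero]
  have hx : u (a + x) = u x := by rw [map_add, hua, zero_add]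
  simp only [h0, hx, sub_zero]
  calc _ ≤ ‖B‖ * ‖g fun _ => u x‖ * ‖u x‖ := B.le_opNorm₂ _ _
    _ ≤ ‖B‖ * (‖g‖ * (‖u‖ * ‖x‖) ^ m) * (‖u‖ * ‖x‖) := by gcongr; exact u.le_opNorm x
    _ = _ := by rw [mul_pow]; ring

/-- Lower bound for the increment of `w ↦ B (γ w) w` from `b` to `b + l (v - p)`. -/
theorem le_norm_bilin_increment [NormedSpace 𝕜 F] (B : H →L[𝕜] H →L[𝕜] F) (γ : H → H)
    {b v p : H} {l c M : ℝ} (hl0 : 0 ≤ l) (hl1 : l ≤ 1) (hvp : ‖v - p‖ ≤ 1)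
    (hγ : ‖γ (b + (l : 𝕜) • (v - p)) - γ b‖ ≤ l * M) (hc : c ≤ ‖B (γ b) v‖)
    (hM : ‖B (γ b)‖ * ‖p‖ + ‖B‖ * M * (‖b‖ + 1) ≤ c / 2) :
    c / 2 * l ≤ ‖B (γ (b + (l : 𝕜) • (v - p))) (b + (l : 𝕜) • (v - p)) - B (γ b) b‖ := by
  have hnl : ‖(l : 𝕜)‖ = l := by rw [RCLike.norm_ofReal, abs_of_nonneg hl0]
  have hby : ‖b + (l : 𝕜) • (v - p)‖ ≤ ‖b‖ + 1 := by
    refine (norm_add_le _ _).trans ?_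
    gcongr
    rw [norm_smul, hnl]
    exact mul_le_one₀ hl1 (norm_nonneg _) hvp
  -- Main term `l • B (γ b) v`; the errors come from the projection `p` and from the variation of
  -- `γ`.
  have hdec : B (γ (b + (l : 𝕜) • (v - p))) (b + (l : 𝕜) • (v - p)) - B (γ b) b =
      (l : 𝕜) • B (γ b) v - ((l : 𝕜) • B (γ b) p -
        B (γ (b + (l : 𝕜) • (v - p)) - γ b) (b + (l : 𝕜) • (v - p))) := by
    rw [map_sub B, sub_apply]
    generalize B (γ (b + (l : 𝕜) • (v - p))) (b + (l : 𝕜) • (v - p)) = z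
    rw [map_add, map_smul, map_sub, smul_sub]
    abel
  have h1 : ‖B (γ (b + (l : 𝕜) • (v - p)) - γ b) (b + (l : 𝕜) • (v - p))‖ ≤
      l * (‖B‖ * M * (‖b‖ + 1)) := by
    calc _ ≤ ‖B‖ * ‖γ (b + (l : 𝕜) • (v - p)) - γ b‖ * ‖b + (l : 𝕜) • (v - p)‖ :=
          B.le_opNorm₂ _ _
      _ ≤ ‖B‖ * (l * M) * (‖b‖ + 1) := by
        have := (norm_nonneg _).trans hγ
        gcongr
      _ = _ := by ring
  have h2 : ‖(l : 𝕜) • B (γ b) p‖ ≤ l * (‖B (γ b)‖ * ‖p‖) := by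
    rw [norm_smul, hnl]
    gcongr
    exact (B (γ b)).le_opNorm _
  have h3 := norm_sub_norm_le ((l : 𝕜) • B (γ b) v) ((l : 𝕜) • B (γ b) p -
        B (γ (b + (l : 𝕜) • (v - p)) - γ b) (b + (l : 𝕜) • (v - p)))
  rw [← hdec, norm_smul _ (B (γ b) v), hnl] at h3
  have h4 := norm_sub_le ((l : 𝕜) • B (γ b) p)
    (B (γ (b + (l : 𝕜) • (v - p)) - γ b) (b + (l : 𝕜) • (v - p)))
  have h5 := mul_le_mul_of_nonneg_left hc hl0
  have h6 := mul_le_mul_of_nonneg_left hM hl0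
  linarith

theorem not_isSummingAt_bilin [CompleteSpace H] [NormedSpace 𝕜 F] {v : ℕ → H}
    (hv : Orthonormal 𝕜 v) (B : H →L[𝕜] H →L[𝕜] F)
    (hB : ∀ b : H, b ≠ 0 → ∃ c > 0, ∀ᶠ j in atTop, c ≤ ‖B b (v j)‖)
    (G : Submodule 𝕜 H) [FiniteDimensional 𝕜 G] {γ : H → H} {N : H → ℝ}
    (hNsmul : ∀ (c : 𝕜) y, N (c • y) = ‖c‖ * N y)
    (hγN : ∀ R, ∃ K, ∀ x b, ‖x‖ ≤ R → ‖b‖ ≤ R → ‖γ x - γ b‖ ≤ K * N (x - b))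
    (hN : ∀ y : ℕ → H, (∀ j, ‖y j‖ ≤ 1) →
      (∀ φ : StrongDual 𝕜 H, Tendsto (fun j => φ (y j)) atTop (𝓝 0)) →
        Tendsto (fun j => N (y j)) atTop (𝓝 0))
    {a : H} (ha : γ (Gᗮ.starProjection a) ≠ 0) :
    ¬ IsSummingAt 𝕜 1 1 (fun x => B (γ (Gᗮ.starProjection x)) (Gᗮ.starProjection x)) a := by
  have huv : ∀ x, Gᗮ.starProjection x = x - G.starProjection x := fun x => by
    rw [Submodule.starProjection_orthogonal]; rfl
  obtain ⟨c, hc, hcB⟩ := hB _ ha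
  set b := Gᗮ.starProjection a with hb
  obtain ⟨K, hK⟩ := hγN (‖b‖ + 1)
  have hy1 : ∀ j, ‖v j - G.starProjection (v j)‖ ≤ 1 := fun j => by
    rw [← huv]
    exact (Gᗮ.norm_starProjection_apply_le _).trans_eq (hv.1 j)
  -- The projections of `v j` onto `Gᗮ` are weakly null, because `φ` composed with the projection is
  -- again a functional.
  have hNy := hN (fun j => v j - G.starProjection (v j)) hy1 fun φ => by
    have := hv.tendsto_inner_zero
      ((InnerProductSpace.toDual 𝕜 H).symm (φ.comp Gᗮ.starProjection))
    simpa only [InnerProductSpace.toDual_symm_apply, ContinuousLinearMap.comp_apply, huv]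
      using this
  have herr : Tendsto (fun j => ‖B (γ b)‖ * ‖G.starProjection (v j)‖ +
      ‖B‖ * (K * N (v j - G.starProjection (v j))) * (‖b‖ + 1)) atTop (𝓝 0) := by
    simpa using ((hv.tendsto_starProjection_zero G).norm.const_mul ‖B (γ b)‖).add
      (((hNy.const_mul K).const_mul ‖B‖).mul_const (‖b‖ + 1))
  refine not_isSummingAt_of_eventually_le hv (half_pos hc) ?_
  filter_upwards [hcB, herr.eventually (ge_mem_nhds (half_pos hc))] with j hj1 hj2
  have hl0 : 0 ≤ 1 / ((j : ℝ) + 1) := by positivity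
  have hl1 : 1 / ((j : ℝ) + 1) ≤ 1 := by rw [div_le_one (by positivity)]; simp
  generalize 1 / ((j : ℝ) + 1) = l at hl0 hl1 ⊢
  rw [map_add Gᗮ.starProjection, map_smul Gᗮ.starProjection, ← hb, huv (v j)]
  refine le_norm_bilin_increment B γ hl0 hl1 (hy1 j) ?_ hj1 hj2
  have hnl : ‖(l : 𝕜)‖ = l := by rw [RCLike.norm_ofReal, abs_of_nonneg hl0]
  have hby : ‖b + (l : 𝕜) • (v j - G.starProjection (v j))‖ ≤ ‖b‖ + 1 := by
    refine (norm_add_le _ _).trans ?_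
    gcongr
    rw [norm_smul, hnl]
    exact mul_le_one₀ hl1 (norm_nonneg _) (hy1 j)
  refine (hK _ b hby (by linarith)).trans_eq ?_
  rw [add_sub_cancel_left, hNsmul, hnl]
  ring

theorem exists_homogeneousPolynomial_summingSet_eq [CompleteSpace H] [NormedSpace 𝕜 F]
    [TopologicalSpace.SeparableSpace H] {v : ℕ → H} (hv : Orthonormal 𝕜 v)
    (B : H →L[𝕜] H →L[𝕜] F)
    (hB : ∀ b : H, b ≠ 0 → ∃ c > 0, ∀ᶠ j in atTop, c ≤ ‖B b (v j)‖)
    {n : ℕ} (hn : 2 ≤ n) (G : Submodule 𝕜 H) [FiniteDimensional 𝕜 G] :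
    ∃ Q : H → F, IsHomogeneousPolynomial 𝕜 n Q ∧ summingSet 𝕜 1 1 Q = (G : Set H) := by
  obtain ⟨m, rfl⟩ : ∃ m, n = m + 1 := ⟨n - 1, by omega⟩
  have hm : m ≠ 0 := by omega
  obtain ⟨g, N, hg0, hNsmul, hgN, hN⟩ := exists_diagonal_polynomial hv hm
  have hu0 : ∀ x, Gᗮ.starProjection x = 0 ↔ x ∈ G := fun x => by
    rw [Submodule.starProjection_apply_eq_zero_iff, Submodule.orthogonal_orthogonal]
  refine ⟨fun x => B (g fun _ => Gᗮ.starProjection x) (Gᗮ.starProjection x),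
    isHomogeneousPolynomial_bilin B g Gᗮ.starProjection, Set.ext fun a => ⟨fun hQ => ?_, fun ha =>
      isSummingAt_bilin_of_map_eq_zero hm B g _ ((hu0 a).2 ha)⟩⟩
  by_contra haG
  exact not_isSummingAt_bilin hv B hB G (γ := fun x => g fun _ => x) hNsmul hgN hN
    (fun h => haG ((hu0 a).1 (hg0 _ h))) hQ

theorem not_lineable_of_finiteDimensional (G : Submodule 𝕜 H) [FiniteDimensional 𝕜 G] :
    ¬ Lineable 𝕜 (G : Set H) := by
  rintro ⟨V, hV, hVG⟩
  have hle : V ≤ G := fun x hx => (hVG hx).elim id fun h => by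
    rw [Set.mem_singleton_iff.1 h]; exact G.zero_mem
  exact hV (Submodule.finiteDimensional_of_le hle)

end SummingSet

/-! ### Cosines in L² and a lower bound for L¹ norms of products. -/

section Cosine

open Real in
theorem integral_cos_int_mul (k : ℤ) :
    ∫ t in (-π)..π, cos (k * t) = if k = 0 then 2 * π else 0 := by
  split_ifs with h
  · simp [h]; ring
  · have hk : (k : ℝ) ≠ 0 := by exact_mod_cast h
    rw [intervalIntegral.integral_comp_mul_left _ hk]
    simp [Real.sin_int_mul_pi]

open Real in
/-- The `L²`-normalised cosine of frequency `j + 1` on `[-π, π]`. -/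
noncomputable def normalizedCos (j : ℕ) (t : ℝ) : ℝ := cos (((j : ℝ) + 1) * t) / √π

theorem continuous_normalizedCos (j : ℕ) : Continuous (normalizedCos j) := by
  unfold normalizedCos; fun_prop

open Real in
theorem integral_normalizedCos_mul (i j : ℕ) :
    ∫ t in (-π)..π, normalizedCos i t * normalizedCos j t = if i = j then 1 else 0 := by
  have h : ∀ t, normalizedCos i t * normalizedCos j t =
      (2 * π)⁻¹ * (cos (((i : ℤ) - j : ℤ) * t) + cos (((i : ℤ) + j + 2 : ℤ) * t)) := fun t => by
    have hsq : √π * √π = π := Real.mul_self_sqrt pi_pos.le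
    rw [normalizedCos, normalizedCos, div_mul_div_comm, hsq]
    have e1 : (((i : ℤ) - j : ℤ) : ℝ) * t = ((i : ℝ) + 1) * t - ((j : ℝ) + 1) * t := by
      push_cast; ring
    have e2 : (((i : ℤ) + j + 2 : ℤ) : ℝ) * t = ((i : ℝ) + 1) * t + ((j : ℝ) + 1) * t := by
      push_cast; ring
    rw [e1, e2, cos_sub, cos_add]
    field_simp
    ring
  simp_rw [h]
  rw [intervalIntegral.integral_const_mul, intervalIntegral.integral_add
    (Continuous.intervalIntegrable (by fun_prop) _ _)
    (Continuous.intervalIntegrable (by fun_prop) _ _), integral_cos_int_mul, integral_cos_int_mul,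
    if_neg (by omega : ¬ (i : ℤ) + j + 2 = 0)]
  have hpi := pi_ne_zero
  by_cases hij : i = j
  · simp [hij]; field_simp
  · rw [if_neg (by omega), if_neg hij]; simp

open Real in
-- From `|cos θ| ≥ cos² θ = (1 + cos 2θ) / 2`; the doubled frequency `2 (j + 1)` has index `2 j +
-- 1`.
theorem normalizedCos_le_abs (j : ℕ) (t : ℝ) :
    (2 * √π)⁻¹ + 2⁻¹ * normalizedCos (2 * j + 1) t ≤ |normalizedCos j t| := by
  have hs : 0 < √π := sqrt_pos.2 pi_pos
  have e : (((2 * j + 1 : ℕ) : ℝ) + 1) * t = 2 * (((j : ℝ) + 1) * t) := by push_cast; ring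
  rw [normalizedCos, normalizedCos, e, cos_two_mul, abs_div, abs_of_pos hs]
  have h1 : cos (((j : ℝ) + 1) * t) ^ 2 ≤ |cos (((j : ℝ) + 1) * t)| := by
    rw [← sq_abs]
    exact pow_le_of_le_one (abs_nonneg _) (abs_cos_le_one _) two_ne_zero
  calc _ = cos (((j : ℝ) + 1) * t) ^ 2 / √π := by field_simp; ring
    _ ≤ _ := by gcongr

variable (𝕜 : Type*) [RCLike 𝕜]

theorem memLp_two_restrict_Icc {E : Type*} [NormedAddCommGroup E] {w : ℝ → E}
    (hw : Continuous w) (a b : ℝ) : MemLp w 2 (volume.restrict (Set.Icc a b)) := by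
  obtain ⟨C, hC⟩ := isCompact_Icc.exists_bound_of_continuousOn (s := Set.Icc a b) hw.continuousOn
  exact MemLp.of_bound hw.aestronglyMeasurable C
    ((ae_restrict_iff' measurableSet_Icc).2 (.of_forall hC))

theorem memLp_normalizedCos (j : ℕ) :
    MemLp (fun t => (normalizedCos j t : 𝕜)) 2
      (volume.restrict (Set.Icc (-Real.pi) Real.pi)) :=
  memLp_two_restrict_Icc (RCLike.continuous_ofReal.comp (continuous_normalizedCos j)) _ _

/-- The normalised cosines as elements of `L²([-π, π])`. -/
noncomputable def cosLp (j : ℕ) : LpInterval 𝕜 2 := (memLp_normalizedCos 𝕜 j).toLp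

theorem coeFn_cosLp (j : ℕ) :
    cosLp 𝕜 j =ᵐ[volume.restrict (Set.Icc (-Real.pi) Real.pi)]
      fun t => (normalizedCos j t : 𝕜) := MemLp.coeFn_toLp _

theorem inner_cosLp_eq_ofReal_integral {j : ℕ} {f : LpInterval 𝕜 2} {r : ℝ → ℝ}
    (hf : f =ᵐ[volume.restrict (Set.Icc (-Real.pi) Real.pi)] fun t => (r t : 𝕜)) :
    inner 𝕜 (cosLp 𝕜 j) f =
      ((∫ t in Set.Icc (-Real.pi) Real.pi, normalizedCos j t * r t : ℝ) : 𝕜) := by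
  rw [L2.inner_def, ← integral_ofReal]
  refine integral_congr_ae ?_
  filter_upwards [hf, coeFn_cosLp 𝕜 j] with t h1 h2
  rw [h1, h2, RCLike.inner_apply, RCLike.conj_ofReal]
  push_cast
  ring

theorem orthonormal_cosLp : Orthonormal 𝕜 (cosLp 𝕜) := by
  rw [orthonormal_iff_ite]
  intro i j
  rw [inner_cosLp_eq_ofReal_integral 𝕜 (coeFn_cosLp 𝕜 j), integral_Icc_eq_integral_Ioc,
    ← intervalIntegral.integral_of_le (by linarith [Real.pi_pos]), integral_normalizedCos_mul]
  split_ifs <;> simp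

instance : ENNReal.HolderTriple 2 2 1 := ⟨by rw [inv_one]; exact ENNReal.inv_two_add_inv_two⟩

/-- The pointwise product `L²([-π, π]) × L²([-π, π]) → L¹([-π, π])`. -/
noncomputable def lpMul : LpInterval 𝕜 2 →L[𝕜] LpInterval 𝕜 2 →L[𝕜] LpInterval 𝕜 1 :=
  (ContinuousLinearMap.mul 𝕜 𝕜).holderL _ 2 2 1

theorem coeFn_lpMul (f g : LpInterval 𝕜 2) :
    lpMul 𝕜 f g =ᵐ[volume.restrict (Set.Icc (-Real.pi) Real.pi)] fun t => f t * g t :=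
  ContinuousLinearMap.coeFn_holder (ContinuousLinearMap.mul 𝕜 𝕜) f g

/-- Integrating `normalizedCos_le_abs` against `‖b‖` leaves a fixed positive multiple of the L¹ norm
of `b` plus an oscillating term, which tends to 0 by Bessel because `‖b‖` lies in L². -/
theorem exists_le_norm_lpMul_cosLp {b : LpInterval 𝕜 2} (hb : b ≠ 0) :
    ∃ c > 0, ∀ᶠ j in atTop, c ≤ ‖lpMul 𝕜 b (cosLp 𝕜 j)‖ := by
  set μ := volume.restrict (Set.Icc (-Real.pi) Real.pi) with hμ
  have hspi : 0 < √Real.pi := Real.sqrt_pos.2 Real.pi_pos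
  have hbm : MemLp b 2 μ := Lp.memLp b
  have hbi : Integrable (fun t => ‖b t‖) μ := (hbm.integrable one_le_two).norm
  have hpos : 0 < ∫ t, ‖b t‖ ∂μ := by
    refine (integral_nonneg fun _ => norm_nonneg _).lt_of_ne' fun h0 => hb ?_
    rw [integral_eq_zero_iff_of_nonneg (fun _ => norm_nonneg _) hbi] at h0
    rw [Lp.eq_zero_iff_ae_eq_zero]
    filter_upwards [h0] with t ht using norm_eq_zero.1 ht
  have hfm : MemLp (fun t => ((‖b t‖ : ℝ) : 𝕜)) 2 μ := hbm.norm.ofReal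
  have hlim : Tendsto (fun j => ∫ t, normalizedCos (2 * j + 1) t * ‖b t‖ ∂μ) atTop (𝓝 0) := by
    have h1 := ((orthonormal_cosLp 𝕜).tendsto_inner_zero hfm.toLp).norm
    have h2 : Tendsto (fun j => 2 * j + 1) atTop atTop :=
      tendsto_atTop_mono (fun j => by simp only [id]; omega) tendsto_id
    have h3 := h1.comp h2
    rw [tendsto_zero_iff_norm_tendsto_zero]
    rw [norm_zero] at h3
    refine h3.congr fun j => ?_
    rw [Function.comp_apply, norm_inner_symm,
      inner_cosLp_eq_ofReal_integral 𝕜 hfm.coeFn_toLp, RCLike.norm_ofReal, Real.norm_eq_abs]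
  -- Half of the constant term; the oscillating integral, weighted by `2⁻¹`, eventually costs at
  -- most the other half.
  refine ⟨(2 * √Real.pi)⁻¹ * (∫ t, ‖b t‖ ∂μ) / 2, by positivity, ?_⟩
  have hc : 0 < (2 * √Real.pi)⁻¹ * (∫ t, ‖b t‖ ∂μ) := by positivity
  filter_upwards [hlim.eventually (lt_mem_nhds (neg_lt_zero.2 hc))] with j hj
  have hnorm : ‖lpMul 𝕜 b (cosLp 𝕜 j)‖ = ∫ t, |normalizedCos j t| * ‖b t‖ ∂μ := by
    rw [L1.norm_eq_integral_norm]
    refine integral_congr_ae ?_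
    filter_upwards [coeFn_lpMul 𝕜 b (cosLp 𝕜 j), coeFn_cosLp 𝕜 j] with t h1 h2
    rw [h1, h2, norm_mul, RCLike.norm_ofReal, mul_comm]
  have hmul : ∀ w : ℝ → ℝ, Continuous w → Integrable (fun t => w t * ‖b t‖) μ := fun w hw => by
    have hwm : MemLp w 2 μ := memLp_two_restrict_Icc hw _ _
    exact hwm.integrable_mul hbm.norm
  have hle : ∫ t, ((2 * √Real.pi)⁻¹ * ‖b t‖ + 2⁻¹ * (normalizedCos (2 * j + 1) t * ‖b t‖)) ∂μ ≤
      ∫ t, |normalizedCos j t| * ‖b t‖ ∂μ := by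
    refine integral_mono ((hbi.const_mul _).add
      ((hmul _ (continuous_normalizedCos _)).const_mul _))
      (hmul _ (continuous_normalizedCos j).abs) fun t => ?_
    calc _ = ((2 * √Real.pi)⁻¹ + 2⁻¹ * normalizedCos (2 * j + 1) t) * ‖b t‖ := by ring
      _ ≤ _ := mul_le_mul_of_nonneg_right (normalizedCos_le_abs j t) (norm_nonneg _)
  rw [integral_add (hbi.const_mul _) ((hmul _ (continuous_normalizedCos _)).const_mul _),
    integral_const_mul, integral_const_mul] at hle
  rw [hnorm]
  linarith

end Cosine

theorem mainTheorem6 (𝕜 : Type*) [RCLike 𝕜] (n : ℕ) (hn : 2 ≤ n) :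
    (∀ G : Submodule 𝕜 (LpInterval 𝕜 2), FiniteDimensional 𝕜 G →
      ∃ Q : LpInterval 𝕜 2 → LpInterval 𝕜 1,
        IsHomogeneousPolynomial 𝕜 n Q ∧ summingSet 𝕜 1 1 Q = (G : Set (LpInterval 𝕜 2))) ∧
    (∃ Q : LpInterval 𝕜 2 → LpInterval 𝕜 1,
      IsHomogeneousPolynomial 𝕜 n Q ∧ summingSet 𝕜 1 1 Q ≠ ∅ ∧ summingSet 𝕜 1 1 Q ≠ {0} ∧
        ¬ Lineable 𝕜 (summingSet 𝕜 1 1 Q)) := by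
  have key : ∀ G : Submodule 𝕜 (LpInterval 𝕜 2), FiniteDimensional 𝕜 G →
      ∃ Q : LpInterval 𝕜 2 → LpInterval 𝕜 1,
        IsHomogeneousPolynomial 𝕜 n Q ∧ summingSet 𝕜 1 1 Q = (G : Set (LpInterval 𝕜 2)) := by
    intro G hG
    have : Fact ((2 : ℝ≥0∞) ≠ ∞) := ⟨ENNReal.ofNat_ne_top⟩
    exact exists_homogeneousPolynomial_summingSet_eq (orthonormal_cosLp 𝕜) (lpMul 𝕜)
      (fun _ hb => exists_le_norm_lpMul_cosLp 𝕜 hb) hn G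
  refine ⟨key, ?_⟩
  have hmem := Submodule.mem_span_singleton_self (R := 𝕜) (cosLp 𝕜 0)
  -- Any nonzero finite-dimensional subspace would do; a line is the simplest.
  obtain ⟨Q, hQ, hS⟩ := key (Submodule.span 𝕜 {cosLp 𝕜 0}) inferInstance
  refine ⟨Q, hQ, ?_, fun h => ?_, ?_⟩
  · rw [hS]
    exact Set.Nonempty.ne_empty ⟨_, hmem⟩
  · rw [← SetLike.mem_coe, ← hS, h, Set.mem_singleton_iff] at hmem
    exact (orthonormal_cosLp 𝕜).ne_zero 0 hmem
  · rw [hS]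
    exact not_lineable_of_finiteDimensional _
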